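/- **Definitions.** $\mathrm{per}$ denotes the permanent. The Bernoulli numbers $B_n$ and the Genocchi numbers $G_n$ are given by $$\frac{x}{e^x-1}=\sum_{n\ge 0}B_n\frac{x^n}{n!},\qquad \frac{2x}{e^x+1}=\sum_{n\ge 1}G_n\frac{x^n}{n!}.$$ For $m\ge 1$ let $\tilde L_{2m-1}=(\ell_{i,j})_{1\le i,j\le 2m-1}$ be the $0/1$ matrix with $\ell_{i,j}=1$ if and only if one of the following holds: $1\le i\le m-1$ and $2i\le j\le 2m-1$; or $m\le i\le 2m-2$ and $1\le j\le 2(i-m)+2$; or $i=2m-1$. For $1\le k\le 2m-1$ let $\tilde L_{2m-1,k}$ be the permanent of the submatrix of $\tilde L_{2m-1}$ obtained by deleting the last row and the $k$-th column (for $m=1$ the permanent of the empty matrix is $1$). Let $\mathcal D_{2m+1}$ be the set of permutations $\sigma$ of $\{1,\dots,2m+1\}$ such that for every $1\le i\le 2m$ one has $\sigma(i)>\sigma(i+1)$ if and only if $\sigma(i)$ is even, and let $$K_{2m-1,k}=\#\{\sigma\in\mathcal D_{2m+1}:\sigma(1)=k+1\}.$$ **Theorem.** 1. For all $m\ge 1$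 and $1\le k\le 2m-1$, $\ \tilde L_{2m-1,k}=K_{2m-1,k}$. 2. For all $m\ge 1$, $\ \mathrm{per}(\tilde L_{2m-1})=(-1)^{m+1}G_{2m+2}$. 3. For all $n\ge 1$, $$\mathrm{per}\left[\left\lfloor\frac{2j-k}{n}\right\rfloor\right]_{1\le j,k\le n}=2(2^{n+1}-1)B_{n+1}.$$ -/

import Mathlib

/-- The Genocchi numbers (of the first kind): `2 x / (e ^ x + 1) = ∑ G_n x ^ n / n !`,
read as an identity of formal power series over `ℚ`. -/
noncomputable def genocchi (n : ℕ) : ℚ :=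
  (n.factorial : ℚ) *
    PowerSeries.coeff n (2 * PowerSeries.X * (PowerSeries.exp ℚ + 1)⁻¹ : PowerSeries ℚ)

/-- The `n × n` matrix `[⌊(2 j - k) / n⌋]`, `1 ≤ j, k ≤ n`. The indices in `Fin n` start at `0`,
hence the shifts by `1`. -/
def sunMatrix (n : ℕ) : Matrix (Fin n) (Fin n) ℤ :=
  Matrix.of fun j k => ⌊(2 * ((j : ℚ) + 1) - ((k : ℚ) + 1)) / (n : ℚ)⌋

/-- The entry `ℓ_{i,j}` (`1 ≤ i, j ≤ 2 m - 1`) of the reduced matrix, with indices that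
start at `1`. -/
def reducedEntry (m i j : ℕ) : ℤ :=
  if (1 ≤ i ∧ i ≤ m - 1 ∧ 2 * i ≤ j ∧ j ≤ 2 * m - 1) ∨
      (m ≤ i ∧ i ≤ 2 * m - 2 ∧ 1 ≤ j ∧ j ≤ 2 * (i - m) + 2) ∨ i = 2 * m - 1
  then 1 else 0

/-- The reduced matrix of order `2 m - 1`, for `m ≥ 1`. Its order is written
as `2 * (m - 1) + 1`, so that a row and a column can be deleted. -/
def reducedMatrix (m : ℕ) : Matrix (Fin (2 * (m - 1) + 1)) (Fin (2 * (m - 1) + 1)) ℤ :=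
  Matrix.of fun i j => reducedEntry m (i + 1) (j + 1)

/-- The permanental minor at the bottom row and column `k` of the reduced matrix: the permanent of
the submatrix in which the last row and the column `k` are deleted. -/
def bottomMinor (m : ℕ) (k : Fin (2 * (m - 1) + 1)) : ℤ :=
  ((reducedMatrix m).submatrix (Fin.last (2 * (m - 1))).succAbove k.succAbove).permanent

/-- Dumont permutations of `{1, …, 2 m + 1}`: for `1 ≤ i ≤ 2 m`, one has `σ(i) > σ(i + 1)` if and
only if `σ(i)` is even. An element `x` of `Fin (2 * m + 1)` stands for the letter `x + 1`. -/
def dumontPerms (m : ℕ) : Finset (Equiv.Perm (Fin (2 * m + 1))) :=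
  Finset.univ.filter fun σ =>
    ∀ i : Fin (2 * m), σ i.succ < σ i.castSucc ↔ Even ((σ i.castSucc : ℕ) + 1)

/-- Kreweras' number `K_{2 m - 1, k}`: the number of Dumont permutations of
`{1, …, 2 m + 1}` whose first letter is `k + 1`. -/
def kreweras (m k : ℕ) : ℕ :=
  ((dumontPerms m).filter fun σ => (σ 0 : ℕ) + 1 = k + 1).card

/-! The three claims all rest on expanding permanents row by row, so a permanent is treated as a
list of rows over a set of columns, in which rows may be reordered, split and deleted.

For the minors, a Dumont word on 1, …, 2m+1 ends in 2m+1, since an odd maximum has no admissible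
successor. A form of Foata's correspondence (`pathSum_eq_subarrayPerm`) turns the count of such
words with a given first letter into a permanent of the step relation. There the row of the letter 2
admits only the column 1; deleting both and shifting the columns leaves the bottom minor.

For the full permanent, the complement of a row [2i ≤ c] is an initial segment. Inclusion–exclusion
on these rows yields the recurrence `gandhi`. The umbral functional x^n ↦ G_n, evaluated on central
factorial polynomials, satisfies the same recurrence, whence G_{2m+2}.

For the floor matrix, even order gives a zero row. In order 2m+1 ≥ 3 two rows have a single nonzero
entry; removing them leaves the reduced matrix with its first m-1 rows negated. The identity G_n =
2(1-2^n)B_n finishes. -/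

section RectangularPermanent

/-! ### Permanents of rectangular arrays. -/

variable {α β γ R : Type*} [DecidableEq β] [DecidableEq γ] [CommRing R]

/-- The permanent of a rectangular array, given by the list of its rows and the set of its columns:
the sum over all injective choices of one column per row of the products of the chosen entries. -/
def rowPerm : List (β → R) → Finset β → R
  | [], _ => 1
  | r :: l, S => ∑ c ∈ S, r c * rowPerm l (S.erase c)

@[simp] theorem rowPerm_nil (S : Finset β) : rowPerm ([] : List (β → R)) S = 1 := rfl

theorem rowPerm_cons (r : β → R) (l : List (β → R)) (S : Finset β) :
    rowPerm (r :: l) S = ∑ c ∈ S, r c * rowPerm l (S.erase c) := rfl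

theorem sum_sum_erase_comm (S : Finset β) (f : β → β → R) :
    ∑ c ∈ S, ∑ d ∈ S.erase c, f c d = ∑ d ∈ S, ∑ c ∈ S.erase d, f c d := by
  refine Finset.sum_comm' fun c d => ?_
  simp only [Finset.mem_erase]
  tauto

theorem rowPerm_swap (r s : β → R) (l : List (β → R)) (S : Finset β) :
    rowPerm (r :: s :: l) S = rowPerm (s :: r :: l) S := by
  simp only [rowPerm_cons, Finset.mul_sum]
  rw [sum_sum_erase_comm]
  refine Finset.sum_congr rfl fun c _ => Finset.sum_congr rfl fun d _ => ?_
  rw [Finset.erase_right_comm]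
  ring

theorem rowPerm_perm {l₁ l₂ : List (β → R)} (h : l₁.Perm l₂) (S : Finset β) :
    rowPerm l₁ S = rowPerm l₂ S := by
  induction h generalizing S with
  | nil => rfl
  | cons r _ ih => simp only [rowPerm_cons, ih]
  | swap r s l => exact rowPerm_swap _ _ _ _
  | trans _ _ ih₁ ih₂ => rw [ih₁, ih₂]

theorem rowPerm_sub_cons (r s : β → R) (l : List (β → R)) (S : Finset β) :
    rowPerm ((r - s) :: l) S = rowPerm (r :: l) S - rowPerm (s :: l) S := by
  simp only [rowPerm_cons, ← Finset.sum_sub_distrib, Pi.sub_apply, sub_mul]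

theorem rowPerm_neg_append (l₁ l₂ : List (β → R)) (S : Finset β) :
    rowPerm (l₁.map (- ·) ++ l₂) S = (-1) ^ l₁.length * rowPerm (l₁ ++ l₂) S := by
  induction l₁ generalizing S with
  | nil => simp
  | cons r l ih =>
    simp only [List.map_cons, List.cons_append, rowPerm_cons, ih, List.length_cons,
      Finset.mul_sum, Pi.neg_apply]
    refine Finset.sum_congr rfl fun c _ => ?_
    ring

theorem rowPerm_map_congr (L : List α) {f g : α → β → R} {S : Finset β}
    (h : ∀ i ∈ L, ∀ c ∈ S, f i c = g i c) : rowPerm (L.map f) S = rowPerm (L.map g) S := by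
  induction L generalizing S with
  | nil => rfl
  | cons i L ih =>
    simp only [List.map_cons, rowPerm_cons]
    refine Finset.sum_congr rfl fun c hc => ?_
    rw [h i (by simp) c hc, ih fun j hj d hd => h j (by simp [hj]) d (Finset.mem_of_mem_erase hd)]

theorem rowPerm_columns_map (e : γ ↪ β) (l : List (β → R)) (S : Finset γ) :
    rowPerm l (S.map e) = rowPerm (l.map (· ∘ e)) S := by
  induction l generalizing S with
  | nil => rfl
  | cons r l ih =>
    simp only [List.map_cons, rowPerm_cons, Finset.sum_map, Function.comp_apply]
    refine Finset.sum_congr rfl fun c _ => ?_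
    rw [← Finset.map_erase, ih]

theorem rowPerm_cons_eq_single {r : β → R} {S : Finset β} {c : β} (hc : c ∈ S)
    (h : ∀ d ∈ S, d ≠ c → r d = 0) (l : List (β → R)) :
    rowPerm (r :: l) S = r c * rowPerm l (S.erase c) := by
  rw [rowPerm_cons]
  exact Finset.sum_eq_single c (fun d hd hne => by rw [h d hd hne, zero_mul])
    fun h' => absurd hc h'

theorem rowPerm_eq_zero_of_mem {r : β → R} {l : List (β → R)} {S : Finset β} (hr : r ∈ l)
    (h : ∀ c ∈ S, r c = 0) : rowPerm l S = 0 := by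
  obtain ⟨l', hl'⟩ : ∃ l', l.Perm (r :: l') := by
    obtain ⟨s, t, rfl⟩ := List.append_of_mem hr
    exact ⟨s ++ t, List.perm_middle⟩
  rw [rowPerm_perm hl', rowPerm_cons]
  exact Finset.sum_eq_zero fun c hc => by rw [h c hc, zero_mul]

theorem rowPerm_cons_indicator {p : β → Prop} [DecidablePred p] {l : List (β → R)} {S : Finset β}
    {v : R} (h : ∀ c ∈ S, p c → rowPerm l (S.erase c) = v) :
    rowPerm ((fun c => if p c then 1 else 0) :: l) S = (S.filter p).card * v := by
  simp only [rowPerm_cons, ite_mul, one_mul, zero_mul]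
  rw [← Finset.sum_filter, Finset.sum_congr rfl
    fun c hc => h c (Finset.mem_filter.1 hc).1 (Finset.mem_filter.1 hc).2]
  simp

theorem rowPerm_replicate_one (n : ℕ) (S : Finset β) :
    rowPerm (List.replicate n (fun _ => (1 : R))) S = (S.card.descFactorial n : R) := by
  induction n generalizing S with
  | zero => simp
  | succ n ih =>
    rw [List.replicate_succ, rowPerm_cons,
      Finset.sum_congr rfl fun c hc => by rw [ih, Finset.card_erase_of_mem hc, one_mul]]
    rw [Finset.sum_const, nsmul_eq_mul]
    cases S.card with
    | zero => simp only [Nat.cast_zero, zero_mul, Nat.zero_descFactorial_succ]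
    | succ k => rw [Nat.succ_descFactorial_succ, Nat.cast_mul, Nat.add_sub_cancel]

theorem injective_cons_mem_iff {n : ℕ} {S : Finset β} (y : β) (g : Fin n → β) :
    (Function.Injective (Fin.cons y g : Fin (n + 1) → β) ∧
      ∀ i, (Fin.cons y g : Fin (n + 1) → β) i ∈ S) ↔
      y ∈ S ∧ Function.Injective g ∧ ∀ i, g i ∈ S.erase y := by
  rw [Fin.cons_injective_iff, Fin.forall_fin_succ]
  simp only [Fin.cons_zero, Fin.cons_succ, Finset.mem_erase, Set.mem_range, not_exists]
  constructor
  · rintro ⟨⟨h₁, h₂⟩, h₃, h₄⟩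
    exact ⟨h₃, h₂, fun i => ⟨h₁ i, h₄ i⟩⟩
  · rintro ⟨h₁, h₂, h₃⟩
    exact ⟨⟨fun i => (h₃ i).1, h₂⟩, h₁, fun i => (h₃ i).2⟩

theorem sum_injective_succ [Fintype β] {n : ℕ} (S : Finset β) (F : (Fin (n + 1) → β) → R) :
    ∑ f with Function.Injective f ∧ ∀ i, f i ∈ S, F f =
      ∑ y ∈ S, ∑ g with Function.Injective g ∧ ∀ i, g i ∈ S.erase y, F (Fin.cons y g) := by
  have h (y : β) (g : Fin n → β) : Fin.consEquiv (fun _ => β) (y, g) = Fin.cons y g := rfl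
  simp only [Finset.sum_filter]
  rw [← (Fin.consEquiv fun _ => β).sum_comp, Fintype.sum_prod_type,
    ← Finset.sum_subset (Finset.subset_univ S)]
  · refine Finset.sum_congr rfl fun y hy => Finset.sum_congr rfl fun g _ => ?_
    simp only [h, injective_cons_mem_iff, hy, true_and]
  · intro y _ hy
    simp only [h, injective_cons_mem_iff, hy, false_and, if_false,
      Finset.sum_const_zero]

theorem rowPerm_ofFn [Fintype β] {n : ℕ} (M : Fin n → β → R) (S : Finset β) :
    rowPerm (List.ofFn M) S =
      ∑ f with Function.Injective f ∧ ∀ i, f i ∈ S, ∏ i, M i (f i) := by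
  induction n generalizing S with
  | zero => simp [Function.injective_of_subsingleton]
  | succ n ih =>
    rw [List.ofFn_succ, rowPerm_cons, sum_injective_succ]
    simp only [ih, Fin.prod_univ_succ, Fin.cons_zero, Fin.cons_succ, Finset.mul_sum]

theorem sum_injective_eq_sum_perm {n : ℕ} (F : (Fin n → Fin n) → R) :
    ∑ f with Function.Injective f, F f = ∑ σ : Equiv.Perm (Fin n), F σ := by
  symm
  refine Finset.sum_bij (fun σ _ => σ) (fun σ _ => by simp [σ.injective])
    (fun σ _ τ _ h => DFunLike.coe_injective h) (fun f hf => ?_) fun _ _ => rfl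
  have hf' : Function.Injective f := by simpa using hf
  exact ⟨Equiv.ofBijective f (Finite.injective_iff_bijective.1 hf'), by simp, rfl⟩

theorem permanent_eq_rowPerm {n : ℕ} (M : Matrix (Fin n) (Fin n) R) :
    M.permanent = rowPerm (List.ofFn fun i => M i) Finset.univ := by
  rw [rowPerm_ofFn, ← Matrix.permanent_transpose]
  simp only [Finset.mem_univ, implies_true, and_true]
  rw [sum_injective_eq_sum_perm (fun f => ∏ i, M i (f i))]
  rfl

end RectangularPermanent

/-! ### Weighted injective walks. -/

section PathSum

variable {α β R : Type*} [DecidableEq α] [DecidableEq β] [CommRing R]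

/-- The weighted sum over the injective walks of `r` steps which start at `x` and continue in `S`,
where the step from `x` to `y` has weight `q x y`. -/
def pathSum (q : α → α → R) : ℕ → α → Finset α → R
  | 0, _, _ => 1
  | r + 1, x, S => ∑ y ∈ S, q x y * pathSum q r y (S.erase y)

theorem pathSum_succ (q : α → α → R) (r : ℕ) (x : α) (S : Finset α) :
    pathSum q (r + 1) x S = ∑ y ∈ S, q x y * pathSum q r y (S.erase y) := rfl

theorem pathSum_map (e : α ↪ β) (q : β → β → R) (r : ℕ) (x : α) (S : Finset α) :
    pathSum q r (e x) (S.map e) = pathSum (fun a b => q (e a) (e b)) r x S := by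
  induction r generalizing x S with
  | zero => rfl
  | succ r ih =>
    simp only [pathSum_succ, Finset.sum_map]
    refine Finset.sum_congr rfl fun y _ => ?_
    rw [← Finset.map_erase, ih]

theorem pathSum_eq_sum [Fintype α] (q : α → α → R) (r : ℕ) (x : α) (S : Finset α) :
    pathSum q r x S = ∑ f : Fin r → α with Function.Injective f ∧ ∀ i, f i ∈ S,
      ∏ i, q ((Fin.cons x f : Fin (r + 1) → α) i.castSucc) (f i) := by
  induction r generalizing x S with
  | zero => simp [pathSum, Function.injective_of_subsingleton]
  | succ r ih =>
    rw [pathSum_succ, sum_injective_succ]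
    refine Finset.sum_congr rfl fun y _ => ?_
    rw [ih, Finset.mul_sum]
    refine Finset.sum_congr rfl fun g _ => ?_
    simp only [Fin.prod_univ_succ, Fin.cons_zero, Fin.castSucc_zero, ← Fin.succ_castSucc,
      Fin.cons_succ]

theorem sum_perm_eq_pathSum {r : ℕ} (q : Fin (r + 1) → Fin (r + 1) → R) (a : Fin (r + 1)) :
    ∑ σ : Equiv.Perm (Fin (r + 1)), (if σ 0 = a then ∏ i : Fin r, q (σ i.castSucc) (σ i.succ)
      else 0) = pathSum q r a (Finset.univ.erase a) := by
  rw [← sum_injective_eq_sum_perm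
    (fun f => if f 0 = a then ∏ i : Fin r, q (f i.castSucc) (f i.succ) else 0)]
  have h := sum_injective_succ (R := R) (Finset.univ : Finset (Fin (r + 1)))
    (fun f => if f 0 = a then ∏ i : Fin r, q (f i.castSucc) (f i.succ) else 0)
  simp only [Finset.mem_univ, implies_true, and_true, Fin.cons_zero, Fin.cons_succ] at h
  rw [h, Finset.sum_eq_single a, pathSum_eq_sum]
  · simp
  · intro y _ hy
    simp [hy]
  · simp

end PathSum

/-! ### Dumont words as permanents. -/

section Foata

/-- The permanent of the array with the rows `w x`, `x ∈ A`, and the columns `C`. -/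
noncomputable def subarrayPerm {R : Type*} [CommRing R] (w : ℕ → ℕ → R) (A C : Finset ℕ) : R :=
  rowPerm (A.toList.map w) C

theorem subarrayPerm_expand {R : Type*} [CommRing R] (w : ℕ → ℕ → R) {A : Finset ℕ} {x : ℕ}
    (hx : x ∈ A) (C : Finset ℕ) :
    subarrayPerm w A C = ∑ y ∈ C, w x y * subarrayPerm w (A.erase x) (C.erase y) := by
  have h := Finset.toList_insert (Finset.notMem_erase x A)
  rw [Finset.insert_erase hx] at h
  rw [subarrayPerm, rowPerm_perm (h.map w), List.map_cons, rowPerm_cons]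
  rfl

/-- The indicator of the relation that in a Dumont word allows the letter `y` after `x`. -/
def dumontStep (x y : ℕ) : ℤ := if y < x ↔ Even x then 1 else 0

theorem pathSum_dumontStep_eq_zero {n r : ℕ} {S : Finset ℕ} (hn : Odd n) (hS : ∀ y ∈ S, y < n) :
    pathSum dumontStep (r + 1) n S = 0 := by
  refine Finset.sum_eq_zero fun y hy => ?_
  rw [dumontStep, if_neg, zero_mul]
  simp [hS y hy, hn]

/-- At least one more step must follow, and the odd maximum n has no successor; so n is not the next
letter. -/
theorem pathSum_insert {n r x : ℕ} {S : Finset ℕ} (hn : Odd n) (hS : ∀ y ∈ S, y < n) :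
    pathSum dumontStep (r + 2) x (insert n S) =
      ∑ y ∈ S, dumontStep x y * pathSum dumontStep (r + 1) y (insert n (S.erase y)) := by
  have hnS : n ∉ S := fun h => (hS n h).false
  rw [pathSum_succ, Finset.sum_insert hnS, Finset.erase_insert hnS,
    pathSum_dumontStep_eq_zero hn hS, mul_zero, zero_add]
  refine Finset.sum_congr rfl fun y hy => ?_
  rw [Finset.erase_insert_of_ne (hS y hy).ne']

/-- Foata's correspondence between words and permutations, in terms of weighted counts: the Dumont
words on `insert n S` with first letter `f` and last letter `n`. -/
theorem pathSum_eq_subarrayPerm {n : ℕ} (hn : Odd n) (r : ℕ) {S : Finset ℕ} {e f : ℕ}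
    (hr : S.card = r + 1) (hS : ∀ y ∈ S, y < n) (he : e ∈ S) (hmin : ∀ y ∈ S, e ≤ y)
    (hf : f ∈ S) :
    pathSum dumontStep (r + 1) f (insert n (S.erase f)) =
      if Odd e then subarrayPerm dumontStep (S.erase e) (S.erase f) else 0 := by
  induction r generalizing S e f with
  | zero =>
    obtain ⟨a, rfl⟩ := Finset.card_eq_one.1 hr
    obtain rfl := Finset.mem_singleton.1 he
    obtain rfl := Finset.mem_singleton.1 hf
    have := (hS f hf).not_gt
    rw [Finset.erase_singleton, insert_empty_eq, pathSum_succ, Finset.sum_singleton]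
    simp [pathSum, dumontStep, subarrayPerm, this]
  | succ r ih =>
    have hT {y : ℕ} : ∀ z ∈ S.erase y, z < n := fun z hz => hS z (Finset.mem_of_mem_erase hz)
    have hcard {y : ℕ} (hy : y ∈ S) : (S.erase y).card = r + 1 := by
      rw [Finset.card_erase_of_mem hy, hr, Nat.add_sub_cancel]
    rw [pathSum_insert hn hT]
    by_cases hfe : f = e
    -- The first letter is the minimum, which has no row in the permanent. The row of the next
    -- smallest letter g takes its place: if both are odd, the two rows consist of ones on the
    -- remaining columns.
    · subst hfe
      obtain ⟨g, hg, hgmin⟩ : ∃ g ∈ S.erase f, ∀ y ∈ S.erase f, g ≤ y :=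
        (S.erase f).exists_min_image id (Finset.card_pos.1 (by rw [hcard hf]; omega))
      rw [Finset.sum_congr rfl fun y hy => by rw [ih (hcard hf) hT hg hgmin hy]]
      have hlt {y : ℕ} (hy : y ∈ S.erase f) : f < y :=
        lt_of_le_of_ne (hmin y (Finset.mem_of_mem_erase hy)) (Finset.ne_of_mem_erase hy).symm
      split_ifs with h1 h2 h2
      · rw [subarrayPerm_expand _ hg]
        refine Finset.sum_congr rfl fun y hy => ?_
        congr 1
        simp [dumontStep, (hlt hy).not_gt, (hgmin y hy).not_gt, h1, h2]
      -- An even minimum has no smaller letter to be followed by.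
      · refine Finset.sum_eq_zero fun y hy => ?_
        simp only [Nat.not_odd_iff_even] at h2
        simp [dumontStep, (hlt hy).not_gt, h2]
      -- If g is even, its row vanishes on the columns, all of which are at least g.
      · rw [subarrayPerm_expand _ hg]
        refine Finset.sum_congr rfl fun y hy => ?_
        simp only [Nat.not_odd_iff_even] at h1
        simp [dumontStep, (hgmin y hy).not_gt, h1]
      · simp
    -- Otherwise deleting f keeps the minimum, and the first step of the word is the expansion along
    -- row f.
    · have he' : e ∈ S.erase f := Finset.mem_erase.2 ⟨Ne.symm hfe, he⟩
      have hf' : f ∈ S.erase e := Finset.mem_erase.2 ⟨hfe, hf⟩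
      rw [Finset.sum_congr rfl fun y hy => by
        rw [ih (hcard hf) hT he' (fun z hz => hmin z (Finset.mem_of_mem_erase hz)) hy]]
      split_ifs
      · rw [subarrayPerm_expand _ hf', Finset.erase_right_comm]
      · simp

/-- The letter, counted from `1`, for which an element of `Fin n` stands. -/
def finLetter (n : ℕ) : Fin n ↪ ℕ := Fin.valEmbedding.trans (addRightEmbedding 1)

@[simp] theorem finLetter_apply {n : ℕ} (i : Fin n) : finLetter n i = i + 1 := rfl

theorem kreweras_eq_pathSum {m k : ℕ} (hk : k < 2 * m) :
    (kreweras m k : ℤ) = pathSum dumontStep (2 * m) (k + 1)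
      (insert (2 * m + 1) ((Finset.Icc 1 (2 * m)).erase (k + 1))) := by
  have h1 : insert (2 * m + 1) ((Finset.Icc 1 (2 * m)).erase (k + 1)) =
      (Finset.univ.erase (⟨k, by omega⟩ : Fin (2 * m + 1))).map (finLetter _) := by
    ext x
    simp only [Finset.mem_insert, Finset.mem_erase, Finset.mem_Icc, Finset.mem_map,
      Finset.mem_univ, and_true, finLetter_apply, ne_eq, Fin.ext_iff]
    constructor
    · intro h
      exact ⟨⟨x - 1, by omega⟩, by simp only; omega, by simp only; omega⟩
    · rintro ⟨a, ha, rfl⟩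
      have := a.isLt
      omega
  rw [h1, show k + 1 = finLetter (2 * m + 1) ⟨k, by omega⟩ from rfl, pathSum_map, ← sum_perm_eq_pathSum, kreweras,
    dumontPerms, Finset.filter_filter, Finset.card_filter, Nat.cast_sum]
  refine Finset.sum_congr rfl fun σ _ => ?_
  simp only [dumontStep, Finset.prod_boole, finLetter_apply, Fin.ext_iff,
    Finset.mem_univ, true_implies, Nat.add_right_cancel_iff, Nat.add_lt_add_iff_right,
    Fin.lt_def, Nat.cast_ite, Nat.cast_one, Nat.cast_zero]
  split_ifs <;> tauto

end Foata

/-! ### Genocchi and Bernoulli numbers. -/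

section Genocchi

theorem genocchi_generating_function :
    (PowerSeries.mk fun n => genocchi n / n.factorial) * (PowerSeries.exp ℚ + 1) =
      2 * PowerSeries.X := by
  have h : (PowerSeries.mk fun n => genocchi n / n.factorial) =
      2 * PowerSeries.X * (PowerSeries.exp ℚ + 1)⁻¹ := by
    ext n
    rw [PowerSeries.coeff_mk, genocchi, mul_div_cancel_left₀ _ (by positivity)]
  rw [h, mul_assoc, PowerSeries.inv_mul_cancel _ (by simp [PowerSeries.constantCoeff_exp]),
    mul_one]

theorem sum_choose_mul_genocchi (n : ℕ) :
    ∑ k ∈ Finset.range (n + 1), (n.choose k : ℚ) * genocchi k + genocchi n =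
      if n = 1 then 2 else 0 := by
  have h := congrArg (PowerSeries.coeff n) genocchi_generating_function
  rw [mul_add, mul_one, map_add, PowerSeries.coeff_mul, PowerSeries.coeff_mk,
    Finset.Nat.sum_antidiagonal_eq_sum_range_succ_mk] at h
  have h2 : PowerSeries.coeff n (2 * PowerSeries.X : PowerSeries ℚ) = if n = 1 then 2 else 0 := by
    rw [show (2 : PowerSeries ℚ) = PowerSeries.C (2 : ℚ) from (map_ofNat _ 2).symm,
      PowerSeries.coeff_C_mul, PowerSeries.coeff_X]
    simp
  rw [h2] at h
  have hn : (n.factorial : ℚ) ≠ 0 := by positivity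
  have h3 : ∀ k ∈ Finset.range (n + 1), (n.choose k : ℚ) * genocchi k =
      n.factorial * (PowerSeries.coeff k (PowerSeries.mk fun n => genocchi n / n.factorial) *
        PowerSeries.coeff (n - k) (PowerSeries.exp ℚ)) := by
    intro k hk
    rw [Nat.cast_choose ℚ (Finset.mem_range_succ_iff.1 hk), PowerSeries.coeff_mk,
      PowerSeries.coeff_exp]
    simp only [eq_ratCast, Rat.cast_id]
    field_simp
  rw [Finset.sum_congr rfl h3, ← Finset.mul_sum]
  have h4 : genocchi n = n.factorial * (genocchi n / n.factorial) := by field_simp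
  rw [h4, ← mul_add]
  erw [h]
  split_ifs with h1 <;> simp [h1]

/-- Partial fractions: 2x/(e^x+1) = 2x/(e^x-1) - 2·2x/(e^{2x}-1). -/
theorem genocchi_eq_bernoulli (n : ℕ) : genocchi n = 2 * (1 - 2 ^ n) * bernoulli n := by
  set B := bernoulliPowerSeries ℚ with hB
  set E := PowerSeries.exp ℚ with hE
  have h1 : B * (E - 1) = PowerSeries.X := bernoulliPowerSeries_mul_exp_sub_one ℚ
  have hE2 : PowerSeries.rescale (2 : ℚ) E = E * E := by
    have := PowerSeries.exp_pow_eq_rescale_exp (A := ℚ) 2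
    rw [sq] at this
    exact_mod_cast this.symm
  have h2 : PowerSeries.rescale (2 : ℚ) B * (E * E - 1) = 2 * PowerSeries.X := by
    have := congrArg (PowerSeries.rescale (2 : ℚ)) h1
    rw [map_mul, map_sub, map_one, hE2, PowerSeries.rescale_X] at this
    rwa [show PowerSeries.C (2 : ℚ) = 2 from map_ofNat _ 2] at this
  have hne : E - 1 ≠ 0 := by
    intro h
    rw [h, mul_zero] at h1
    exact PowerSeries.X_ne_zero h1.symm
  have hne' : E + 1 ≠ 0 := by
    intro h
    have := congrArg PowerSeries.constantCoeff h
    simp [hE, PowerSeries.constantCoeff_exp] at this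
  have h3 : (PowerSeries.mk fun n => genocchi n / n.factorial) =
      2 * B - 2 * PowerSeries.rescale (2 : ℚ) B := by
    apply mul_right_cancel₀ hne'
    rw [genocchi_generating_function]
    apply mul_right_cancel₀ hne
    linear_combination 2 * h2 - 2 * (E + 1) * h1
  have h4 := congrArg (PowerSeries.coeff n) h3
  rw [show (2 : PowerSeries ℚ) = PowerSeries.C (2 : ℚ) from (map_ofNat _ 2).symm] at h4
  simp only [PowerSeries.coeff_mk, map_sub, PowerSeries.coeff_C_mul, PowerSeries.coeff_rescale, hB,
    bernoulliPowerSeries, eq_ratCast, Rat.cast_id] at h4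
  field_simp at h4
  linear_combination h4

/-! ### Umbral evaluation of the Gandhi recurrence. -/

open Polynomial

/-- The umbral functional of the Genocchi numbers, which sends `x ^ n` to `G_n`. -/
noncomputable def genocchiFunctional : ℚ[X] →ₗ[ℚ] ℚ :=
  Polynomial.lsum fun n => genocchi n • LinearMap.id

@[simp] theorem genocchiFunctional_X_pow (n : ℕ) : genocchiFunctional (X ^ n) = genocchi n := by
  rw [genocchiFunctional, Polynomial.lsum_apply, ← Polynomial.monomial_one_right_eq_X_pow,
    Polynomial.sum_monomial_index] <;> simp

/-- The umbral form of (e^x+1)·∑ G_n x^n/n! = 2x. -/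
theorem genocchiFunctional_comp_add (p : ℚ[X]) :
    genocchiFunctional (p.comp (X + 1)) + genocchiFunctional p = 2 * p.derivative.eval 0 := by
  induction p using Polynomial.induction_on' with
  | add p q hp hq =>
    simp only [add_comp, map_add, eval_add]
    linear_combination hp + hq
  | monomial n a =>
    have h : genocchiFunctional ((X + 1) ^ n) =
        ∑ k ∈ Finset.range (n + 1), (n.choose k : ℚ) * genocchi k := by
      rw [add_pow, map_sum]
      refine Finset.sum_congr rfl fun k _ => ?_
      rw [one_pow, mul_one, mul_comm, ← nsmul_eq_mul, map_nsmul, nsmul_eq_mul,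
        genocchiFunctional_X_pow]
    rw [← smul_X_eq_monomial, smul_comp, X_pow_comp, map_smul, map_smul, h, smul_eq_mul,
      smul_eq_mul, ← mul_add, genocchiFunctional_X_pow, sum_choose_mul_genocchi, derivative_smul, derivative_X_pow]
    rcases n with _ | _ | n <;> (simp; try ring)

/-- The odd polynomial `x ∏_{1 ≤ i < k} (x ^ 2 - i ^ 2)` for `k ≥ 1`, indexed by `k - 1`. -/
noncomputable def centralFactorial : ℕ → ℚ[X]
  | 0 => X
  | k + 1 => centralFactorial k * (X ^ 2 - C ((k : ℚ) + 1) ^ 2)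

theorem centralFactorial_comp (k : ℕ) :
    (centralFactorial k).comp (X + 1) * (X - C (k : ℚ)) =
      centralFactorial k * (X + C ((k : ℚ) + 1)) := by
  induction k with
  | zero => simp [centralFactorial]; ring
  | succ k ih =>
    simp only [centralFactorial, mul_comp, sub_comp, pow_comp, X_comp, C_comp]
    simp only [Nat.cast_add, Nat.cast_one, map_add, map_one] at ih ⊢
    linear_combination (X - C (k : ℚ) - 1) * (X + C (k : ℚ) + 2) * ih

theorem centralFactorial_eval_zero (k : ℕ) : (centralFactorial k).eval 0 = 0 := by
  induction k with
  | zero => simp [centralFactorial]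
  | succ k ih => simp [centralFactorial, ih]

theorem centralFactorial_derivative_eval_zero (k : ℕ) :
    (centralFactorial k).derivative.eval 0 = (-1) ^ k * (k.factorial : ℚ) ^ 2 := by
  induction k with
  | zero => simp [centralFactorial]
  | succ k ih =>
    simp [centralFactorial, ih, centralFactorial_eval_zero, Nat.factorial_succ]
    ring

/-- For p = (x-k-1) times the central factorial, the shift identity gives p(x+1) + p(x) as twice x
times the central factorial; so the functional is read off from p'(0). -/
theorem genocchiFunctional_X_mul_centralFactorial (k : ℕ) :
    genocchiFunctional (X * centralFactorial k) =
      (-1) ^ (k + 1) * (k + 1) * (k.factorial : ℚ) ^ 2 := by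
  have h := genocchiFunctional_comp_add (centralFactorial k * (X - C ((k : ℚ) + 1)))
  have h1 : (centralFactorial k * (X - C ((k : ℚ) + 1))).comp (X + 1) =
      centralFactorial k * (X + C ((k : ℚ) + 1)) := by
    rw [← centralFactorial_comp]
    simp
  rw [h1, ← map_add, show centralFactorial k * (X + C ((k : ℚ) + 1)) +
    centralFactorial k * (X - C ((k : ℚ) + 1)) = (2 : ℚ) • (X * centralFactorial k) by
      rw [smul_eq_C_mul, map_ofNat]; ring, map_smul] at h
  simp only [derivative_mul, eval_add, eval_mul, centralFactorial_derivative_eval_zero,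
    centralFactorial_eval_zero] at h
  simp at h
  rw [h]
  ring

/-- The weighted count to which the expansion of the reduced permanent leads. -/
def gandhi : ℕ → ℕ → ℤ
  | 0, c => (c + 1).factorial
  | j + 1, c => (c + 2) * gandhi j (c + 1) - (c + 1) ^ 2 * gandhi j c

/-- Writing x² = (x² - (c+1)²) + (c+1)² reproduces the recurrence of `gandhi`; the factors
(-1)^(c+j) and (c+1)! absorb the sign and the coefficient c+2. -/
theorem gandhi_mul_factorial (j c : ℕ) :
    (gandhi j c : ℚ) * (c + 1).factorial =
      (-1) ^ (c + j) * genocchiFunctional (X ^ (2 * j + 3) * centralFactorial c) := by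
  induction j generalizing c with
  | zero =>
    have h : (X ^ (2 * 0 + 3) * centralFactorial c : ℚ[X]) =
        X * centralFactorial (c + 1) + (((c : ℚ) + 1) ^ 2) • (X * centralFactorial c) := by
      rw [smul_eq_C_mul, centralFactorial]
      simp only [map_pow]
      ring
    rw [h, map_add, map_smul, genocchiFunctional_X_mul_centralFactorial,
      genocchiFunctional_X_mul_centralFactorial, gandhi, Nat.factorial_succ, smul_eq_mul]
    push_cast
    have : ((-1 : ℚ) ^ c) ^ 2 = 1 := by rw [← pow_mul, mul_comm, pow_mul]; simp
    linear_combination (-(c + 1) ^ 2 * (c.factorial : ℚ) ^ 2) * this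
  | succ j ih =>
    have h : (X ^ (2 * (j + 1) + 3) * centralFactorial c : ℚ[X]) =
        X ^ (2 * j + 3) * centralFactorial (c + 1) +
          (((c : ℚ) + 1) ^ 2) • (X ^ (2 * j + 3) * centralFactorial c) := by
      rw [smul_eq_C_mul, centralFactorial]
      simp only [map_pow]
      ring
    have h1 := ih (c + 1)
    rw [h, map_add, map_smul, gandhi, smul_eq_mul]
    push_cast [Nat.factorial_succ] at h1 ih ⊢
    linear_combination h1 - ((c : ℚ) + 1) ^ 2 * ih c

theorem gandhi_eq_genocchi (j : ℕ) : (gandhi j 0 : ℚ) = (-1) ^ j * genocchi (2 * j + 4) := by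
  have h := gandhi_mul_factorial j 0
  rw [centralFactorial, ← pow_succ, genocchiFunctional_X_pow] at h
  simpa using h

end Genocchi

/-! ### The reduced matrix and its full permanent. -/

section Reduced

/-- The row `[c ≤ a]` of a staircase array. -/
def initialRow (a c : ℕ) : ℤ := if c ≤ a then 1 else 0

theorem rowPerm_initialRow_cons {a : ℕ} {l : List (ℕ → ℤ)} {S : Finset ℕ} {v : ℤ}
    (h : ∀ c ∈ S, c ≤ a → rowPerm l (S.erase c) = v) :
    rowPerm (initialRow a :: l) S = (S.filter (· ≤ a)).card * v :=
  rowPerm_cons_indicator h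

theorem card_filter_le_erase {S : Finset ℕ} {c a : ℕ} (hc : c ∈ S) (hca : c ≤ a) :
    ((S.erase c).filter (· ≤ a)).card = (S.filter (· ≤ a)).card - 1 := by
  rw [Finset.filter_erase, Finset.card_erase_of_mem (Finset.mem_filter.2 ⟨hc, hca⟩)]

/-- The permanent of an array of nested rows `[2 i ≤ c]` and `[c ≤ 2 i]`, `t ≤ i < t + j`, with
`c + 1` full rows, where `c` columns are left below `2 t - 1`. -/
theorem rowPerm_eq_gandhi (j t c : ℕ) (S : Finset ℕ)
    (hS : ∀ i ≤ 2 * j + 1, (S.filter (· ≤ 2 * t + i)).card = c + i)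
    (hmax : ∀ x ∈ S, x ≤ 2 * t + (2 * j + 1)) :
    rowPerm ((List.range' (t + 1) j).map (fun i c => if 2 * i ≤ c then 1 else 0) ++
      ((List.range' (t + 1) j).map (fun i => initialRow (2 * i)) ++
        List.replicate (c + 1) (fun _ => 1))) S = gandhi j c := by
  induction j generalizing t c S with
  | zero =>
    have h : S.card = c + 1 := by
      rw [← hS 1 (by omega), Finset.filter_true_of_mem (by simpa using hmax)]
    rw [List.range'_zero, List.map_nil, List.map_nil, List.nil_append, List.nil_append,
      rowPerm_replicate_one, h, Nat.descFactorial_self, gandhi]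
  | succ j ih =>
    -- Expanding the row [x ≤ 2t+2], the shortest initial row left: each of its d+1 columns leaves
    -- the same kind of array, with t+1 for t and d for c.
    have key (l : List (ℕ → ℤ)) (f d : ℕ) (T : Finset ℕ)
        (hT : ∀ i, 2 ≤ i → i ≤ 2 * j + 3 → (T.filter (· ≤ 2 * t + i)).card = d + i - 1)
        (hTmax : ∀ x ∈ T, x ≤ 2 * t + (2 * j + 3))
        (hl : l.Perm (initialRow (2 * (t + 1)) ::
          ((List.range' (t + 2) j).map (fun i c => if 2 * i ≤ c then 1 else 0) ++
            ((List.range' (t + 2) j).map (fun i => initialRow (2 * i)) ++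
              List.replicate (d + 1) (fun _ => 1))))) :
        rowPerm l T = (d + 1) * gandhi j d := by
      rw [rowPerm_perm hl, rowPerm_initialRow_cons (v := gandhi j d)]
      · rw [mul_add, mul_one, hT 2 le_rfl (by omega)]
        push_cast
        ring
      · intro x hx hxt
        refine ih (t + 1) d _ (fun i hi => ?_) fun y hy => ?_
        · rw [card_filter_le_erase hx (by omega), mul_add, mul_one, add_assoc,
            hT (2 + i) (by omega) (by omega)]
          omega
        · have := hTmax y (Finset.mem_of_mem_erase hy)
          omega
    -- The full row raises the number of full rows to c+2 and gives the first term; the subtracted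
    -- row [x ≤ 2t+1] meets c+1 columns, and `key` supplies the second factor c+1.
    have hrow : (fun x => if 2 * (t + 1) ≤ x then 1 else 0 : ℕ → ℤ) =
        (fun _ => 1) - initialRow (2 * t + 1) := by
      funext x
      simp only [initialRow, Pi.sub_apply]
      split_ifs <;> omega
    simp only [List.range'_succ, List.map_cons, List.cons_append]
    rw [hrow, rowPerm_sub_cons, gandhi]
    congr 1
    · rw [key _ 0 (c + 1) S (fun i _ hi => by rw [hS i (by omega)]; omega)
        (fun x hx => by have := hmax x hx; omega)]
      · push_cast; ring
      · refine (List.perm_middle.cons _).trans ((List.Perm.swap _ _ _).trans (List.Perm.cons _ ?_))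
        rw [← List.append_assoc, ← List.append_assoc, List.replicate_succ]
        exact List.perm_middle.symm
    · rw [rowPerm_initialRow_cons (v := (c + 1) * gandhi j c), hS 1 (by omega)]
      · push_cast; ring
      · intro x hx hxt
        refine key _ 0 c _ (fun i hi hi' => ?_) (fun y hy => ?_) List.perm_middle
        · rw [card_filter_le_erase hx (by omega), hS i (by omega)]
        · have := hmax y (Finset.mem_of_mem_erase hy)
          omega

theorem List.ofFn_comp_succ_val {α : Type*} {n : ℕ} (f : ℕ → α) :
    List.ofFn (fun i : Fin n => f (i + 1)) = (List.range' 1 n).map f := by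
  apply List.ext_getElem <;> simp [add_comm]

theorem Finset.univ_map_finLetter (n : ℕ) : Finset.univ.map (finLetter n) = Finset.Icc 1 n := by
  ext x
  simp only [Finset.mem_map, Finset.mem_univ, true_and, finLetter_apply, Finset.mem_Icc]
  constructor
  · rintro ⟨a, rfl⟩
    omega
  · intro h
    exact ⟨⟨x - 1, by omega⟩, by simp only; omega⟩

theorem rowPerm_ofFn_finLetter {n p : ℕ} (f : ℕ → ℕ → ℤ) (S : Finset (Fin n)) :
    rowPerm (List.ofFn fun (i : Fin p) (j : Fin n) => f (i + 1) (j + 1)) S =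
      rowPerm ((List.range' 1 p).map f) (S.map (finLetter n)) := by
  rw [rowPerm_columns_map, ← List.ofFn_comp_succ_val, List.map_ofFn]
  rfl

theorem permanent_of_letters (n : ℕ) (f : ℕ → ℕ → ℤ) :
    (Matrix.of fun i j : Fin n => f (i + 1) (j + 1)).permanent =
      rowPerm ((List.range' 1 n).map f) (Finset.Icc 1 n) := by
  rw [permanent_eq_rowPerm, ← Finset.univ_map_finLetter, ← rowPerm_ofFn_finLetter]
  rfl

theorem reducedMatrix_permanent {m : ℕ} (hm : 1 ≤ m) :
    (reducedMatrix m).permanent = gandhi (m - 1) 0 := by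
  obtain ⟨j, rfl⟩ : ∃ j, m = j + 1 := ⟨m - 1, by omega⟩
  rw [reducedMatrix, permanent_of_letters, Nat.add_sub_cancel,
    ← rowPerm_eq_gandhi j 0 0 (Finset.Icc 1 (2 * j + 1))]
  · rw [rowPerm_map_congr (g := fun i => if i ≤ j then (fun c => if 2 * i ≤ c then 1 else 0) else
      if i ≤ 2 * j then initialRow (2 * (i - j)) else fun _ => 1)]
    · rw [show 2 * j + 1 = j + (j + 1) by omega, ← List.range'_append_1, List.map_append,
        List.range'_1_concat, List.map_append, add_comm 1 j, show List.range' (j + 1) j =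
          (List.range' 1 j).map (j + ·) from (List.map_add_range' 1 j 1).symm, List.map_map]
      congr 2
      · refine List.map_congr_left fun i hi => ?_
        have := List.mem_range'_1.1 hi
        rw [if_pos (by omega)]
      · congr 1
        · refine List.map_congr_left fun i hi => ?_
          have := List.mem_range'_1.1 hi
          simp only [Function.comp_apply]
          rw [if_neg (by omega), if_pos (by omega), Nat.add_sub_cancel_left]
        · simp
          omega
    · intro i hi c hc
      simp only [List.mem_range'_1, Finset.mem_Icc] at hi hc
      simp only [reducedEntry, ite_apply, initialRow]
      split_ifs <;> first | rfl | omega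
  · intro i hi
    rw [show (Finset.Icc 1 (2 * j + 1)).filter (· ≤ 2 * 0 + i) = Finset.Icc 1 i by
      ext x; simp only [Finset.mem_filter, Finset.mem_Icc]; omega]
    simp
  · intro x hx
    have := Finset.mem_Icc.1 hx
    omega

theorem reducedMatrix_permanent_eq_genocchi {m : ℕ} (hm : 1 ≤ m) :
    ((reducedMatrix m).permanent : ℚ) = (-1) ^ (m + 1) * genocchi (2 * m + 2) := by
  obtain ⟨j, rfl⟩ : ∃ j, m = j + 1 := ⟨m - 1, by omega⟩
  rw [reducedMatrix_permanent hm, gandhi_eq_genocchi, Nat.add_sub_cancel, pow_add, pow_add]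
  norm_num
  rfl

/-! ### Bottom minors and Kreweras' numbers. -/

theorem bottomMinor_eq_rowPerm (m : ℕ) (k : Fin (2 * (m - 1) + 1)) :
    bottomMinor m k = rowPerm ((List.range' 1 (2 * (m - 1))).map (reducedEntry m))
      ((Finset.Icc 1 (2 * (m - 1) + 1)).erase (k + 1)) := by
  have h : Finset.univ.map k.succAboveEmb = Finset.univ.erase k := by
    ext x
    simp [Fin.exists_succAbove_eq_iff]
  rw [← Finset.univ_map_finLetter, ← finLetter_apply k, ← Finset.map_erase,
    ← rowPerm_ofFn_finLetter, ← h, rowPerm_columns_map, List.map_ofFn, bottomMinor,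
    permanent_eq_rowPerm]
  congr 2
  funext i j
  simp [reducedMatrix]

theorem bottomMinor_eq_kreweras {m : ℕ} (hm : 1 ≤ m) (k : Fin (2 * (m - 1) + 1)) :
    bottomMinor m k = (kreweras m ((k : ℕ) + 1) : ℤ) := by
  have hk := k.isLt
  obtain ⟨r, hr⟩ : ∃ r, 2 * m = r + 1 := ⟨2 * m - 1, by omega⟩
  have h2 : 2 ∈ (Finset.Icc 1 (2 * m)).erase 1 := by simp; omega
  have h1 : 1 ∈ (Finset.Icc 1 (2 * m)).erase (k + 1 + 1) := by simp; omega
  -- Only the step count is rewritten to r+1; the 2m in the letter sets stays.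
  rw [kreweras_eq_pathSum (by omega), show pathSum dumontStep (2 * m) = _ by rw [hr],
    pathSum_eq_subarrayPerm (e := 1) ⟨m, rfl⟩ r (by simpa using hr)
      (fun y hy => by simp at hy; omega) (by simp; omega) (fun y hy => by simp at hy; omega)
      (by simp; omega), if_pos odd_one, subarrayPerm_expand _ h2, Finset.sum_eq_single_of_mem 1 h1]
  · have h3 : ((Finset.Icc 1 (2 * m)).erase (k + 1 + 1)).erase 1 =
        ((Finset.Icc 1 (2 * (m - 1) + 1)).erase (k + 1)).map (addRightEmbedding 1) := by
      ext x
      simp only [Finset.mem_erase, Finset.mem_map, Finset.mem_Icc, addRightEmbedding_apply]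
      constructor
      · intro h
        exact ⟨x - 1, by omega, by omega⟩
      · rintro ⟨a, h, rfl⟩
        omega
    -- Row i of the reduced matrix belongs to the odd letter 2i+1 in the upper block and to the even
    -- letter 2(i-m)+4 in the lower one.
    have h4 : (((Finset.Icc 1 (2 * m)).erase 1).erase 2).toList.Perm
        ((List.range' 1 (2 * (m - 1))).map
          fun i => if i ≤ m - 1 then 2 * i + 1 else 2 * (i - m) + 4) := by
      refine (List.perm_ext_iff_of_nodup (Finset.nodup_toList _)
        (List.Nodup.map_on (fun x hx y hy => ?_) List.nodup_range')).2 fun x => ?_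
      · simp only [List.mem_range'_1] at hx hy
        split_ifs <;> omega
      · simp only [Finset.mem_toList, Finset.mem_erase, Finset.mem_Icc, List.mem_map,
          List.mem_range'_1]
        constructor
        · intro h
          rcases Nat.even_or_odd' x with ⟨t, rfl | rfl⟩
          · exact ⟨m + t - 2, by omega, by rw [if_neg (by omega)]; omega⟩
          · exact ⟨t, by omega, by rw [if_pos (by omega)]⟩
        · rintro ⟨a, h, rfl⟩
          split_ifs <;> omega
    rw [show dumontStep 2 1 = 1 by simp [dumontStep], one_mul, subarrayPerm,
      rowPerm_perm (h4.map _), h3, rowPerm_columns_map, bottomMinor_eq_rowPerm, List.map_map,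
      List.map_map]
    refine rowPerm_map_congr _ fun i hi c hc => ?_
    simp only [List.mem_range'_1, Finset.mem_erase, Finset.mem_Icc] at hi hc
    simp only [reducedEntry, dumontStep, Function.comp_apply, addRightEmbedding_apply,
      Nat.even_iff]
    split_ifs <;> first | rfl | omega
  · intro y hy hne
    simp only [Finset.mem_erase, Finset.mem_Icc] at hy
    have : ¬ y < 2 := by omega
    simp [dumontStep, this]

/-! ### The floor matrix. -/

/-- The entry `⌊(2 j - k) / n⌋`, for `1 ≤ j, k ≤ n`. -/
def sunEntry (n j k : ℕ) : ℤ := if n + k ≤ 2 * j then 1 else if 2 * j < k then -1 else 0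

theorem floor_eq_sunEntry {n j k : ℕ} (hj : j ≤ n) (hk : 1 ≤ k) (hkn : k ≤ n) :
    ⌊(2 * (j : ℚ) - (k : ℚ)) / (n : ℚ)⌋ = sunEntry n j k := by
  have hn : (0 : ℤ) < n := by omega
  have h : (2 * (j : ℚ) - (k : ℚ)) = ((2 * (j : ℤ) - (k : ℤ) : ℤ) : ℚ) := by push_cast; rfl
  have key {a v : ℤ} (h1 : v * n ≤ a) (h2 : a < (v + 1) * n) : a / (n : ℤ) = v :=
    le_antisymm (Int.lt_add_one_iff.1 (Int.ediv_lt_of_lt_mul hn h2))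
      ((Int.le_ediv_iff_mul_le hn).2 h1)
  rw [h, Rat.floor_intCast_div_natCast, sunEntry]
  split_ifs <;> exact key (by omega) (by omega)

theorem sunMatrix_permanent (n : ℕ) :
    (sunMatrix n).permanent =
      rowPerm ((List.range' 1 n).map (sunEntry n)) (Finset.Icc 1 n) := by
  rw [← permanent_of_letters, sunMatrix]
  congr 2
  funext j k
  rw [← floor_eq_sunEntry (by omega) (by omega) (by omega)]
  push_cast
  rfl

theorem sunMatrix_permanent_of_even {m : ℕ} (hm : 1 ≤ m) :
    (sunMatrix (2 * m)).permanent = 0 := by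
  rw [sunMatrix_permanent]
  refine rowPerm_eq_zero_of_mem (r := sunEntry (2 * m) m)
    (List.mem_map_of_mem (List.mem_range'_1.2 (by omega))) fun c hc => ?_
  have := Finset.mem_Icc.1 hc
  rw [sunEntry, if_neg (by omega), if_neg (by omega)]

/-- Row m is -1 in the last column only, row m+1 is 1 in the first column only. The m-1 rows above
contribute the other signs. -/
theorem sunMatrix_permanent_of_odd {m : ℕ} (hm : 1 ≤ m) :
    (sunMatrix (2 * m + 1)).permanent = (-1) ^ m * (reducedMatrix m).permanent := by
  obtain ⟨t, rfl⟩ : ∃ t, m = t + 1 := ⟨m - 1, by omega⟩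
  have h1 : List.range' 1 (2 * (t + 1) + 1) = List.range' 1 t ++
      (t + 1) :: (t + 2) :: List.range' (t + 3) (t + 1) := by
    rw [show 2 * (t + 1) + 1 = t + ((t + 1) + 2) by omega, ← List.range'_append_1,
      List.range'_succ, List.range'_succ, add_comm 1 t]
  have h2 : (List.range' 1 (2 * (t + 1) + 1)).Perm ((t + 1) :: (t + 2) ::
      (List.range' 1 t ++ List.range' (t + 3) (t + 1))) := by
    rw [h1]
    exact List.perm_middle.trans (List.perm_middle.cons _)
  have h3 : ((Finset.Icc 1 (2 * (t + 1) + 1)).erase (2 * (t + 1) + 1)).erase 1 =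
      (Finset.Icc 1 (2 * t + 1)).map (addRightEmbedding 1) := by
    ext x
    simp only [Finset.mem_erase, Finset.mem_map, Finset.mem_Icc, addRightEmbedding_apply]
    constructor
    · intro h
      exact ⟨x - 1, by omega, by omega⟩
    · rintro ⟨a, h, rfl⟩
      omega
  have h4 : List.range' (t + 3) (t + 1) = (List.range' (t + 1) (t + 1)).map (2 + ·) := by
    rw [List.map_add_range', show 2 + (t + 1) = t + 3 by omega]
  have h5 : List.range' 1 (2 * t + 1) = List.range' 1 t ++ List.range' (t + 1) (t + 1) := by
    rw [show 2 * t + 1 = t + (t + 1) by omega, ← List.range'_append_1, add_comm 1 t]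
  rw [sunMatrix_permanent, rowPerm_perm (h2.map _), List.map_cons, List.map_cons,
    rowPerm_cons_eq_single (c := 2 * (t + 1) + 1) (by simp),
    rowPerm_cons_eq_single (c := 1) (by simp), h3, rowPerm_columns_map, reducedMatrix,
    permanent_of_letters, Nat.add_sub_cancel, List.map_map, h4, List.map_append, List.map_map]
  · have hlow {α : Type} {f g : ℕ → α} (h : ∀ i ≤ t, f i = g i) :
        (List.range' 1 t).map f = (List.range' 1 t).map g :=
      List.map_congr_left fun i hi => h i (by have := List.mem_range'_1.1 hi; omega)
    have hhigh {α : Type} {f g : ℕ → α} (h : ∀ i, t < i → f i = g i) :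
        (List.range' (t + 1) (t + 1)).map f = (List.range' (t + 1) (t + 1)).map g :=
      List.map_congr_left fun i hi => h i (by have := List.mem_range'_1.1 hi; omega)
    -- The surviving rows and columns, renumbered: the row index jumps by 2 over the deleted rows,
    -- the column index shifts by 1.
    let s : ℕ → ℕ → ℤ := fun i c => sunEntry (2 * (t + 1) + 1) (if i ≤ t then i else 2 + i) (c + 1)
    let u : ℕ → ℕ → ℤ := fun i =>
      if i ≤ t then -reducedEntry (t + 1) i else reducedEntry (t + 1) i
    have h6 : rowPerm ((List.range' 1 (2 * t + 1)).map s) (Finset.Icc 1 (2 * t + 1)) =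
        rowPerm ((List.range' 1 (2 * t + 1)).map u) (Finset.Icc 1 (2 * t + 1)) := by
      refine rowPerm_map_congr _ fun i hi c hc => ?_
      simp only [List.mem_range'_1, Finset.mem_Icc] at hi hc
      simp only [s, u, sunEntry, reducedEntry, ite_apply, Pi.neg_apply]
      split_ifs <;> omega
    rw [hlow (g := s) (fun i hi => by funext c; simp [s, hi]),
      hhigh (g := s) (fun i hi => by funext c; simp [s, hi.not_ge]), ← List.map_append, ← h5, h6,
      h5, List.map_append, hlow (g := (- ·) ∘ reducedEntry (t + 1)) (fun i hi => by simp [u, hi]),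
      hhigh (g := reducedEntry (t + 1)) (fun i hi => by simp [u, hi.not_ge]), ← List.map_map,
      rowPerm_neg_append, ← List.map_append, List.length_map, List.length_range', sunEntry,
      if_neg (by omega), if_pos (by omega), sunEntry, if_pos (by omega)]
    ring
  · intro d hd hne
    simp only [Finset.mem_erase, Finset.mem_Icc] at hd
    rw [sunEntry, if_neg (by omega), if_neg (by omega)]
  · intro d hd hne
    simp only [Finset.mem_Icc] at hd
    rw [sunEntry, if_neg (by omega), if_neg (by omega)]

end Reduced

theorem mainTheorem1 :
    (∀ m : ℕ, 1 ≤ m → ∀ k : Fin (2 * (m - 1) + 1),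
      bottomMinor m k = (kreweras m ((k : ℕ) + 1) : ℤ)) ∧
    (∀ m : ℕ, 1 ≤ m →
      ((reducedMatrix m).permanent : ℚ) = (-1) ^ (m + 1) * genocchi (2 * m + 2)) ∧
    (∀ n : ℕ, 1 ≤ n →
      ((sunMatrix n).permanent : ℚ) = 2 * (2 ^ (n + 1) - 1) * bernoulli (n + 1)) := by
  refine ⟨fun m hm k => bottomMinor_eq_kreweras hm k,
    fun m hm => reducedMatrix_permanent_eq_genocchi hm, fun n hn => ?_⟩
  rcases Nat.even_or_odd' n with ⟨m, rfl | rfl⟩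
  · rw [sunMatrix_permanent_of_even (by omega),
      bernoulli_eq_zero_of_odd ⟨m, rfl⟩ (by omega), Int.cast_zero, mul_zero]
  -- Order 1 has no two rows to delete; the matrix is [1] and B_2 = 1/6.
  · rcases Nat.eq_zero_or_pos m with rfl | hm
    · rw [Nat.mul_zero, Nat.zero_add, Matrix.permanent_unique, bernoulli_two]
      norm_num [sunMatrix]
    · rw [sunMatrix_permanent_of_odd hm]
      push_cast
      rw [reducedMatrix_permanent_eq_genocchi hm, genocchi_eq_bernoulli, ← mul_assoc, ← pow_add,
        Odd.neg_one_pow ⟨m, by ring⟩]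
      ring
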